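/- Let $\mathcal H=\ell^2(\mathbb N,\mathbb C)$ be the Hilbert space of one bosonic mode with Fock basis $(|n\rangle)_{n\ge 0}$, let $a|n\rangle=\sqrt n\,|n-1\rangle$ and $a^\dagger|n\rangle=\sqrt{n+1}\,|n+1\rangle$, and let $X=(a+a^\dagger)/\sqrt2$, $P=(a-a^\dagger)/(i\sqrt2)$. For $\beta,\xi\in\mathbb C$ let $D(\beta)=\exp(\beta a^\dagger-\beta^*a)$ and $S(\xi)=\exp\!\big(\tfrac12\xi (a^\dagger)^2-\tfrac12\xi^*a^2\big)$ be the displacement and squeezing operators (the unitary operators obtained at time $1$ from the strongly continuous one-parameter unitary groups generated by the exponents), and for $N\ge 0$ let $$\nu_N=\frac1{1+N}\sum_{n=0}^\infty\Big(\frac{N}{1+N}\Big)^n|n\rangle\langle n|$$ be the thermal state. A single-mode Gaussian state is an operator of the form $$\rho=D(\beta)\,S(\xi)\,\nu_N\,S(\xi)^\dagger D(\beta)^\dagger,\qquad \xi=re^{i\psi},\quad \beta\in\mathbb C,\ r,\psi\in\mathbb R,\ N\ge 0 .$$ A state $\rho$ is incoherent if its matrix in the Fock basis is diagonal, i.e.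 $\langle m|\rho|n\rangle=0$ for all $m\ne n$. The covariance matrix of $\rho$ is the real $2\times2$ matrix $\sigma_{jk}=\tfrac12\langle R_jR_k+R_kR_j\rangle-\langle R_j\rangle\langle R_k\rangle$, where $(R_1,R_2)=(X,P)$ and $\langle A\rangle=\mathrm{Tr}(\rho A)=\sum_n\langle n|\rho A|n\rangle$. Theorem. Let $\rho=D(\beta)S(re^{i\psi})\nu_N S(re^{i\psi})^\dagger D(\beta)^\dagger$ be a single-mode Gaussian state. Then: 1. $\rho$ is incoherent if and only if its covariance matrix exists and is diagonal, there is no displacement ($\beta=0$) and there is no squeezing ($r=0$). 2. $\rho$ is incoherent if and only if $\beta=0$ and $r=0$; equivalently, if and only if $\rho=\nu_N$. 3. If $\rho$ is incoherent, then its covariance matrix exists and equals $\tfrac{1+2N}{2}\,I$. Consequently, an operator on $\mathcal H$ is an incoherent single-mode Gaussian state if and only if it is a thermal state $\nu_{N}$ for some $N\ge0$. -/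

import Mathlib

noncomputable section

namespace SingleMode

/-- The Hilbert space of one bosonic mode, in the occupation-number representation: `ℓ²(ℕ, ℂ)`. -/
abbrev Fock : Type := lp (fun _ : ℕ => ℂ) 2

/-- The Fock (number) state `|n⟩`. -/
def ket (n : ℕ) : Fock := lp.single 2 n (1 : ℂ)

/-- Vectors with finitely many nonzero Fock amplitudes, the common invariant domain (a core) on
which polynomials in the ladder operators are defined. -/
abbrev FiniteFock : Type := ℕ →₀ ℂ

/-- The dense inclusion of the finite vectors into the Hilbert space, `δₙ ↦ |n⟩`. -/
def incl : FiniteFock →ₗ[ℂ] Fock := Finsupp.linearCombination ℂ ket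

/-- The annihilation operator, `a |n⟩ = √n |n - 1⟩` (and `a |0⟩ = 0`, since then `√n = 0`). -/
def annihilation : Module.End ℂ FiniteFock :=
  Finsupp.linearCombination ℂ
    (fun n : ℕ => Finsupp.single (n - 1) ((Real.sqrt (n : ℝ) : ℝ) : ℂ))

/-- The creation operator, `a† |n⟩ = √(n + 1) |n + 1⟩`. -/
def creation : Module.End ℂ FiniteFock :=
  Finsupp.linearCombination ℂ
    (fun n : ℕ => Finsupp.single (n + 1) ((Real.sqrt ((n : ℝ) + 1) : ℝ) : ℂ))

/-- `U` is a strongly continuous one-parameter unitary group whose infinitesimal generator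
extends the operator `A` given on the finite vectors. -/
structure IsUnitaryGroupOf (A : Module.End ℂ FiniteFock) (U : ℝ → (Fock →L[ℂ] Fock)) :
    Prop where
  unitary : ∀ t, U t ∈ unitary (Fock →L[ℂ] Fock)
  zero : U 0 = 1
  add : ∀ s t, U (s + t) = U s * U t
  continuous : ∀ x, Continuous fun t => U t x
  generator : ∀ v, HasDerivAt (fun t => U t (incl v)) (incl (A v)) 0

open Classical in
/-- The unitary operator `exp A`, for an operator `A` on the finite vectors that is essentially
skew-adjoint: the value at time `1` of the unique one-parameter unitary group generated by `A`
(Stone's theorem). -/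
def unitaryExp (A : Module.End ℂ FiniteFock) : Fock →L[ℂ] Fock :=
  if h : ∃! U : ℝ → (Fock →L[ℂ] Fock), IsUnitaryGroupOf A U then h.choose 1 else 0

/-- The displacement operator `D(β) = exp (β a† - β* a)`. -/
def displacement (β : ℂ) : Fock →L[ℂ] Fock :=
  unitaryExp (β • creation - (starRingEnd ℂ β) • annihilation)

/-- The squeezing operator `S(ξ) = exp (½ ξ (a†)² - ½ ξ* a²)`. -/
def squeezing (ξ : ℂ) : Fock →L[ℂ] Fock :=
  unitaryExp ((1 / 2 * ξ) • creation ^ 2 - (1 / 2 * starRingEnd ℂ ξ) • annihilation ^ 2)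

/-- The thermal state with mean photon number `N ≥ 0`,
`ν = (1 / (1 + N)) ∑ₙ (N / (1 + N))ⁿ |n⟩⟨n|` (a series converging in operator norm). -/
def thermal (N : ℝ) : Fock →L[ℂ] Fock :=
  ((1 / (1 + N) : ℝ) : ℂ) •
    ∑' n : ℕ, (((N / (1 + N)) ^ n : ℝ) : ℂ) • InnerProductSpace.rankOne ℂ (ket n) (ket n)

/-- The single-mode Gaussian state `D(β) S(ξ) ν S(ξ)† D(β)†` with `ξ = r e^{iψ}`. -/
def gaussianState (β : ℂ) (r ψ N : ℝ) : Fock →L[ℂ] Fock :=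
  displacement β * squeezing ((r : ℂ) * Complex.exp (Complex.I * (ψ : ℂ))) * thermal N *
    ContinuousLinearMap.adjoint (squeezing ((r : ℂ) * Complex.exp (Complex.I * (ψ : ℂ)))) *
    ContinuousLinearMap.adjoint (displacement β)

/-- `ρ` is a single-mode Gaussian state. -/
def IsGaussianState (ρ : Fock →L[ℂ] Fock) : Prop :=
  ∃ (β : ℂ) (r ψ N : ℝ), 0 ≤ N ∧ ρ = gaussianState β r ψ N

/-- `ρ` is incoherent: its matrix in the Fock basis is diagonal. -/
def IsIncoherent (ρ : Fock →L[ℂ] Fock) : Prop :=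
  ∀ m n : ℕ, m ≠ n → inner ℂ (ket m) (ρ (ket n)) = 0

/-- The quadratures `X = (a + a†) / √2` (index `0`) and `P = (a - a†) / (i √2)` (index `1`). -/
def quadrature : Fin 2 → Module.End ℂ FiniteFock :=
  ![(1 / (Real.sqrt 2 : ℂ)) • (annihilation + creation),
    (1 / (Complex.I * (Real.sqrt 2 : ℂ))) • (annihilation - creation)]

/-- The expectation value `⟨A⟩ = Tr (ρ A) = ∑ₙ ⟨n| ρ A |n⟩` exists and equals `x`. -/
def HasExpectation (ρ : Fock →L[ℂ] Fock) (A : Module.End ℂ FiniteFock) (x : ℝ) : Prop :=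
  HasSum (fun n : ℕ => inner ℂ (ket n) (ρ (incl (A (Finsupp.single n 1))))) (x : ℂ)

/-- The first and second moments of `ρ` exist, and `σ` is its covariance matrix
`σⱼₖ = ½ ⟨Rⱼ Rₖ + Rₖ Rⱼ⟩ - ⟨Rⱼ⟩ ⟨Rₖ⟩`, where `R = (X, P)`. Here `d` is the displacement vector
`(⟨X⟩, ⟨P⟩)`. Such a `σ` is unique, as sums are. -/
def HasCovarianceMatrix (ρ : Fock →L[ℂ] Fock) (σ : Matrix (Fin 2) (Fin 2) ℝ) : Prop :=
  ∃ d : Fin 2 → ℝ,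
    (∀ j, HasExpectation ρ (quadrature j) (d j)) ∧
    ∀ j k, HasExpectation ρ
      ((1 / 2 : ℂ) • (quadrature j * quadrature k + quadrature k * quadrature j))
      (σ j k + d j * d k)

end SingleMode

end

noncomputable section
namespace SingleMode
open Filter Topology

/-! The largest eigenvalue 1/(1+N) of the thermal state is simple, with eigenvector |0⟩, so the same
eigenvalue of ρ is simple with eigenvector φ = D S|0⟩. If ρ is diagonal in the Fock basis, any m
with ⟨m|φ⟩ ≠ 0 makes |m⟩ an eigenvector for that eigenvalue too; by simplicity D†|m⟩ is a multiple
of S|0⟩ (`IsIncoherent.eq_zero`). With ξ = r e and |e| = 1, the squeezed vacuum is annihilated by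
cosh r · a − e sinh r · a†. Moving this operator through D† leaves a finite vector that must vanish:
its coefficient at |m+1⟩ is −e sinh r √(m+1), forcing r = 0, and then its coefficient at |m⟩ is −β
(`eq_zero_of_adjoint_displacement_ket`). Conversely D(0) = S(0) = 1, and the moments of ν_N are
geometric sums.

The analytic work is to show that D and S exist and conjugate the ladder operators as expected. Both
exponents are skew and banded, with entries growing at most linearly, so A^n v grows at most like
K^n n! on finite vectors v (`exists_seminorm_pow_le`). This analytic-vector bound yields existence
of the group as a strong limit of exponentials of compressions (`exists_isUnitaryGroupOf`). Through
a Taylor argument (`eq_zero_of_hasDerivAt`) it also yields uniqueness and the Heisenberg equations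
(`IsUnitaryGroupOf.inner_eq`). -/

/-! ### The Fock basis and the dense subspace of finite vectors. -/

lemma inner_ket (n : ℕ) (x : Fock) : inner ℂ (ket n) x = x n := by
  simp [ket, lp.inner_single_left]

lemma ket_apply (m n : ℕ) : ket m n = if n = m then 1 else 0 := by
  by_cases h : n = m
  · subst h; simp [ket]
  · simp [ket, h, lp.single_apply]

@[simp] lemma norm_ket (n : ℕ) : ‖ket n‖ = 1 := by
  simp [ket, lp.norm_single]

lemma incl_single (n : ℕ) (z : ℂ) : incl (Finsupp.single n z) = z • ket n := by
  simp [incl]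

lemma hasSum_ket (x : Fock) : HasSum (fun n => x n • ket n) x := by
  have := lp.hasSum_single (p := 2) (by simp) x
  convert this using 2 with n
  ext k
  simp [ket, lp.single_apply, Pi.single_apply]

lemma denseRange_incl : DenseRange incl := by
  intro x
  refine mem_closure_of_tendsto (hasSum_ket x) (Eventually.of_forall fun s => ?_)
  refine ⟨∑ n ∈ s, Finsupp.single n (x n), ?_⟩
  simp [incl_single]

lemma ext_incl {F : Type*} [TopologicalSpace F] [T2Space F] {f g : Fock → F}
    (hf : Continuous f) (hg : Continuous g) (h : ∀ v, f (incl v) = g (incl v)) (x : Fock) :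
    f x = g x :=
  congrFun (denseRange_incl.equalizer hf hg (funext h)) x

lemma ext_ket {F : Type*} [NormedAddCommGroup F] [NormedSpace ℂ F] {f g : Fock →L[ℂ] F}
    (h : ∀ n, f (ket n) = g (ket n)) : f = g := by
  ext1 x
  refine ext_incl f.continuous g.continuous (fun v => ?_) x
  have : (f : Fock →ₗ[ℂ] F) ∘ₗ incl = (g : Fock →ₗ[ℂ] F) ∘ₗ incl := by
    ext n
    simp [incl_single, h]
  exact LinearMap.congr_fun this v

lemma incl_apply (v : FiniteFock) (n : ℕ) : incl v n = v n := by
  induction v using Finsupp.induction_linear with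
  | zero => simp
  | add f g hf hg => simp [hf, hg]
  | single m z =>
    rw [incl_single, lp.coeFn_smul, Pi.smul_apply, ket_apply, Finsupp.single_apply]
    simp [eq_comm]

lemma incl_injective : Function.Injective incl := fun v w h => by
  ext n
  rw [← incl_apply, h, incl_apply]

/-! ### Ladder operators, formal adjoints and banded exponents. -/

lemma annihilation_single (n : ℕ) (z : ℂ) : annihilation (Finsupp.single n z) =
    Finsupp.single (n - 1) (z * (Real.sqrt n : ℝ)) := by
  simp [annihilation]

lemma creation_single (n : ℕ) (z : ℂ) : creation (Finsupp.single n z) =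
    Finsupp.single (n + 1) (z * (Real.sqrt ((n : ℝ) + 1) : ℝ)) := by
  simp [creation]

/-- `B` is a formal adjoint of `A` on the finite vectors. -/
def IsFormalAdjoint (A B : Module.End ℂ FiniteFock) : Prop :=
  ∀ v w, inner ℂ (incl (A v)) (incl w) = inner ℂ (incl v) (incl (B w))

lemma IsFormalAdjoint.symm {A B : Module.End ℂ FiniteFock} (h : IsFormalAdjoint A B) :
    IsFormalAdjoint B A := fun v w => by
  rw [← inner_conj_symm, ← h, inner_conj_symm]

lemma IsFormalAdjoint.mul {A B A' B' : Module.End ℂ FiniteFock} (h : IsFormalAdjoint A B)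
    (h' : IsFormalAdjoint A' B') : IsFormalAdjoint (A * A') (B' * B) := fun v w => by
  simp only [Module.End.mul_apply]
  rw [h, h']

lemma isFormalAdjoint_annihilation : IsFormalAdjoint annihilation creation := fun v w => by
  induction v using Finsupp.induction_linear with
  | zero => simp
  | add f g hf hg => simp only [map_add, inner_add_left, hf, hg]
  | single m z =>
    induction w using Finsupp.induction_linear with
    | zero => simp
    | add f g hf hg => simp only [map_add, inner_add_right, hf, hg]
    | single n y =>
      rw [annihilation_single, creation_single]
      simp only [incl_single, inner_smul_left, inner_smul_right, inner_ket, ket_apply]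
      rcases m with _ | m
      · simp
      · by_cases h : m = n
        · subst h; simp; ring
        · simp [h]

/-- `A` is formally skew-adjoint on the finite vectors. -/
def IsFormallySkew (A : Module.End ℂ FiniteFock) : Prop :=
  ∀ v w, inner ℂ (incl (A v)) (incl w) = - inner ℂ (incl v) (incl (A w))

lemma IsFormalAdjoint.isFormallySkew {A B : Module.End ℂ FiniteFock} (h : IsFormalAdjoint A B)
    (z : ℂ) : IsFormallySkew (z • B - (starRingEnd ℂ z) • A) := fun v w => by
  simp only [LinearMap.sub_apply, LinearMap.smul_apply, map_sub, map_smul, inner_sub_left,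
    inner_sub_right, inner_smul_left, inner_smul_right, h v w, h.symm v w, Complex.conj_conj]
  ring

/-- `A` is a two-band operator on the finite vectors, with linearly growing matrix entries. -/
def IsBanded (d : ℕ) (c : ℝ) (A : Module.End ℂ FiniteFock) : Prop :=
  ∀ k : ℕ, ∃ x y : ℂ, A (Finsupp.single k 1) = Finsupp.single (k + d) x + Finsupp.single (k - d) y ∧
    ‖x‖ ≤ c * (k + 2) ∧ ‖y‖ ≤ c * (k + 2)

lemma isBanded_displacement (z : ℂ) :
    IsBanded 1 ‖z‖ (z • creation - (starRingEnd ℂ z) • annihilation) := fun k => by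
  refine ⟨z * (Real.sqrt ((k : ℝ) + 1) : ℝ), -(starRingEnd ℂ z * (Real.sqrt k : ℝ)), ?_, ?_, ?_⟩
  · simp [annihilation_single, creation_single, sub_eq_add_neg]
  · rw [norm_mul, Complex.norm_real, Real.norm_of_nonneg (Real.sqrt_nonneg _)]
    gcongr
    exact Real.sqrt_le_iff.2 ⟨by positivity, by nlinarith⟩
  · rw [norm_neg, norm_mul, Complex.norm_real, Real.norm_of_nonneg (Real.sqrt_nonneg _),
      RCLike.norm_conj]
    gcongr
    exact Real.sqrt_le_iff.2 ⟨by positivity, by nlinarith⟩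

lemma isBanded_squeezing (z : ℂ) :
    IsBanded 2 ‖z‖ (z • creation ^ 2 - (starRingEnd ℂ z) • annihilation ^ 2) := fun k => by
  -- For k < 2 the index k - 2 is truncated to 0, which is harmless because √k √(k-1) is then 0. The
  -- bound k + 2 comes from √((k+1)(k+2)).
  refine ⟨z * (Real.sqrt ((k : ℝ) + 1) * Real.sqrt ((k : ℝ) + 1 + 1) : ℝ),
    -(starRingEnd ℂ z * (Real.sqrt k * Real.sqrt ((k - 1 : ℕ) : ℝ) : ℝ)), ?_, ?_, ?_⟩
  · simp [annihilation_single, creation_single, sub_eq_add_neg, pow_two, Nat.add_assoc,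
      Nat.sub_sub, -Finsupp.single_mul]
  · rw [norm_mul, Complex.norm_real, Real.norm_of_nonneg (by positivity), ← Real.sqrt_mul (by positivity)]
    gcongr
    exact Real.sqrt_le_iff.2 ⟨by positivity, by nlinarith⟩
  · rw [norm_neg, norm_mul, Complex.norm_real, Real.norm_of_nonneg (by positivity),
      RCLike.norm_conj, ← Real.sqrt_mul (by positivity)]
    gcongr
    have : ((k - 1 : ℕ) : ℝ) ≤ k := by exact_mod_cast Nat.sub_le k 1
    exact Real.sqrt_le_iff.2 ⟨by positivity, by nlinarith⟩

/-! ### Factorial growth of powers of a banded operator. -/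

-- Each factor is at most 2(k+1+j), and the rising factorial of k+1 equals n! times a binomial
-- coefficient, itself at most 2^(k+n).
open scoped Nat in
lemma prod_range_le (k n : ℕ) :
    ∏ j ∈ Finset.range n, (k + 2 * j + 2) ≤ 2 ^ n * (2 ^ (k + n) * n !) := by
  have h1 : ∏ j ∈ Finset.range n, (k + 2 * j + 2) ≤ ∏ j ∈ Finset.range n, 2 * (k + 1 + j) :=
    Finset.prod_le_prod' fun j _ => by omega
  rw [Finset.prod_mul_distrib, Finset.prod_const, Finset.card_range,
    ← Nat.ascFactorial_eq_prod_range, Nat.ascFactorial_eq_factorial_mul_choose] at h1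
  refine h1.trans (Nat.mul_le_mul_left _ ?_)
  rw [mul_comm]
  exact Nat.mul_le_mul_right _ (Nat.choose_le_two_pow _ _)

/-- Path counting: T^n sends |k⟩ along 2^n paths, the level rises by at most 2 per step, and step j
costs at most c(k+2j+2). Allowing a seminorm that grows linearly in the level covers ‖a v‖ and ‖a†
v‖ as well as ‖v‖. -/
lemma IsBanded.seminorm_pow_single_le {d : ℕ} {c : ℝ} (hd : d ≤ 2) (hc : 0 ≤ c)
    {T : Module.End ℂ FiniteFock} (hT : IsBanded d c T) (q : Seminorm ℂ FiniteFock)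
    (hq : ∀ j : ℕ, q (Finsupp.single j 1) ≤ j + 1) (n k : ℕ) :
    q ((T ^ n) (Finsupp.single k 1)) ≤
      (2 * c) ^ n * (∏ j ∈ Finset.range n, (k + 2 * j + 2) : ℕ) * (k + 2 * n + 1) := by
  induction n generalizing k with
  | zero => simpa using hq k
  | succ n ih =>
    obtain ⟨x, y, hxy, hx, hy⟩ := hT k
    have key : ∀ m ≤ k + 2, ∀ z : ℂ, ‖z‖ ≤ c * (k + 2) →
        q ((T ^ n) (Finsupp.single m z)) ≤ c * (k + 2) * ((2 * c) ^ n *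
          (∏ j ∈ Finset.range n, (k + 2 + 2 * j + 2) : ℕ) * (k + 2 + 2 * n + 1)) := by
      intro m hm z hz
      have : Finsupp.single m z = z • Finsupp.single m (1 : ℂ) := by simp
      rw [this, map_smul, map_smul_eq_mul]
      have hm' : (m : ℝ) ≤ k + 2 := by exact_mod_cast hm
      gcongr
      refine (ih m).trans ?_
      gcongr
    rw [pow_succ, Module.End.mul_apply, hxy, map_add]
    refine (map_add_le_add _ _ _).trans
      ((add_le_add (key _ (by omega) x hx) (key _ (by omega) y hy)).trans (le_of_eq ?_))
    rw [Finset.prod_range_succ']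
    have : ∀ j, k + 2 * (j + 1) + 2 = k + 2 + 2 * j + 2 := fun j => by ring
    simp only [this]
    push_cast
    ring

open scoped Nat in
/-- Finite vectors are analytic vectors of banded operators, uniformly in the operator. -/
lemma exists_seminorm_pow_le {d : ℕ} {c : ℝ} (hd : d ≤ 2) (hc : 0 ≤ c)
    (q : Seminorm ℂ FiniteFock) (hq : ∀ j : ℕ, q (Finsupp.single j 1) ≤ j + 1) (v : FiniteFock) :
    ∃ C, 0 ≤ C ∧ ∀ T, IsBanded d c T → ∀ n : ℕ, q ((T ^ n) v) ≤ C * (32 * c) ^ n * n ! := by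
  induction v using Finsupp.induction_linear with
  | zero => exact ⟨0, le_rfl, by simp⟩
  | add f g hf hg =>
    obtain ⟨C, hC, h⟩ := hf
    obtain ⟨C', hC', h'⟩ := hg
    refine ⟨C + C', by positivity, fun T hT n => ?_⟩
    rw [map_add, add_mul, add_mul]
    exact (map_add_le_add _ _ _).trans (add_le_add (h T hT n) (h' T hT n))
  | single k z =>
    refine ⟨‖z‖ * (2 * 4 ^ k), by positivity, fun T hT n => ?_⟩
    have : Finsupp.single k z = z • Finsupp.single k (1 : ℂ) := by simp
    rw [this, map_smul, map_smul_eq_mul, mul_assoc, mul_assoc]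
    gcongr
    refine (hT.seminorm_pow_single_le hd hc q hq n k).trans ?_
    have h1 : ((∏ j ∈ Finset.range n, (k + 2 * j + 2) : ℕ) : ℝ) ≤ 2 ^ n * (2 ^ (k + n) * n !) := by
      exact_mod_cast prod_range_le k n
    have h2 : (k : ℝ) + 2 * n + 1 ≤ 2 ^ (k + 2 * n + 1) := by
      exact_mod_cast (Nat.lt_two_pow_self (n := k + 2 * n + 1)).le
    -- The rate 32 = 2·2·2·4 collects the number of paths, the two powers of 2 in `prod_range_le`,
    -- and 2^(2n) from the linear factor.
    calc (2 * c) ^ n * (∏ j ∈ Finset.range n, (k + 2 * j + 2) : ℕ) * (k + 2 * n + 1)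
        ≤ (2 * c) ^ n * (2 ^ n * (2 ^ (k + n) * n !)) * 2 ^ (k + 2 * n + 1) := by gcongr
      _ = 2 * 4 ^ k * ((32 * c) ^ n * n !) := by
        have e4 : (4 : ℝ) = 2 ^ 2 := by norm_num
        have e32 : (32 : ℝ) = 2 ^ 5 := by norm_num
        rw [e4, e32, mul_pow, mul_pow, ← pow_mul, ← pow_mul]
        ring

/-! ### Vanishing of curves with factorially bounded derivatives. -/

open scoped Nat in
/-- A family of curves `G v` with `(G v)' = G (A v)` that vanishes at `0` and whose derivatives
grow at most like `Kⁿ n!`, locally uniformly, vanishes for all positive times. -/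
lemma eq_zero_of_hasDerivAt {V E : Type*} [AddCommGroup V] [Module ℂ V] [NormedAddCommGroup E]
    [NormedSpace ℝ E] (A : Module.End ℂ V) (G : V → ℝ → E)
    (hG : ∀ v t, HasDerivAt (G v) (G (A v) t) t) (h0 : ∀ v, G v 0 = 0) {K : ℝ} (hK : 0 ≤ K)
    (hb : ∀ (T : ℝ) (v : V), ∃ C, ∀ (n : ℕ), ∀ t ∈ Set.Icc 0 T,
      ‖G ((A ^ n) v) t‖ ≤ C * K ^ n * n !) (v : V) {t : ℝ} (ht : 0 ≤ t) : G v t = 0 := by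
  -- This makes K δ ≤ 1/2, so Taylor remainders of order n on an interval of length δ are at most C
  -- 2^(-n). The length depends on neither the base point nor v, so finitely many steps reach any t.
  set δ : ℝ := 1 / (2 * (K + 1)) with hδ
  have hδ0 : 0 < δ := by positivity
  -- All derivatives at s are themselves values G (A^j v) s, hence zero; only the remainder is left,
  -- and integrating the bound n times gives it.
  have taylor : ∀ (s : ℝ) (M : ℝ), (∀ v, G v s = 0) → ∀ (n : ℕ) (v : V),
      (∀ t ∈ Set.Icc s (s + δ), ‖G ((A ^ n) v) t‖ ≤ M) →
      ∀ t ∈ Set.Icc s (s + δ), ‖G v t‖ ≤ M * ((t - s) ^ n / n !) := by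
    intro s M hs n
    induction n with
    | zero => intro v h t ht; simpa using h t ht
    | succ n ih =>
      intro v h
      have h1 := ih (A v) (by simpa [pow_succ] using h)
      refine image_norm_le_of_norm_deriv_right_le_deriv_boundary
        (f' := fun t => G (A v) t) (B' := fun t => M * ((t - s) ^ n / n !))
        (fun t _ => (hG v t).continuousAt.continuousWithinAt)
        (fun t _ => (hG v t).hasDerivWithinAt) (by simp [hs]) (fun t => ?_)
        (fun t ht => h1 t ⟨ht.1, ht.2.le⟩)
      have := ((((hasDerivAt_id t).sub_const s).pow (n + 1)).div_const ((n + 1)! : ℝ)).const_mul M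
      refine this.congr_deriv ?_
      simp only [id, Nat.add_sub_cancel, mul_one, Nat.factorial_succ]
      push_cast
      field_simp
  have step : ∀ s, 0 ≤ s → (∀ v, G v s = 0) → ∀ t ∈ Set.Icc s (s + δ), ∀ v, G v t = 0 := by
    intro s hs0 hs t ht v
    obtain ⟨C, hC⟩ := hb (s + δ) v
    have hle : ∀ n : ℕ, ‖G v t‖ ≤ C * (1 / 2) ^ n := by
      intro n
      have hC0 : 0 ≤ C := by
        have := (norm_nonneg _).trans (hC 0 s ⟨hs0, by linarith⟩)
        simpa using this
      refine (taylor s _ hs n v (fun t ht => hC n t ⟨hs0.trans ht.1, ht.2⟩) t ht).trans ?_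
      have h1 : K * (t - s) ≤ 1 / 2 := by
        calc K * (t - s) ≤ K * δ := by gcongr; linarith [ht.2]
          _ ≤ 1 / 2 := by
            rw [hδ, mul_one_div, div_le_div_iff₀ (by positivity) (by positivity)]; linarith
      have h2 : 0 ≤ K * (t - s) := mul_nonneg hK (by linarith [ht.1])
      calc C * K ^ n * n ! * ((t - s) ^ n / n !) = C * (K * (t - s)) ^ n := by
            rw [mul_pow]; field_simp
        _ ≤ C * (1 / 2) ^ n := by gcongr
    have hlim : Tendsto (fun n : ℕ => C * (1 / 2 : ℝ) ^ n) atTop (𝓝 0) := by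
      simpa using (tendsto_pow_atTop_nhds_zero_of_lt_one (r := (1 / 2 : ℝ)) (by norm_num)
        (by norm_num)).const_mul C
    exact norm_le_zero_iff.1 (ge_of_tendsto' hlim hle)
  have all : ∀ m : ℕ, ∀ t ∈ Set.Icc 0 (m * δ), ∀ v, G v t = 0 := by
    intro m
    induction m with
    | zero =>
      intro t ht v
      obtain rfl : t = 0 := le_antisymm (by simpa using ht.2) ht.1
      exact h0 v
    | succ m ih =>
      intro t ht v
      rcases le_total t (m * δ) with h | h
      · exact ih t ⟨ht.1, h⟩ v
      · refine step (m * δ) (by positivity) (ih _ ⟨by positivity, le_rfl⟩) t ⟨h, ?_⟩ v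
        have := ht.2
        push_cast at this
        linarith
  obtain ⟨m, hm⟩ := exists_nat_ge (t / δ)
  exact all m t ⟨ht, (div_le_iff₀ hδ0).1 hm⟩ v

/-! ### Compressions to finitely many levels and their unitary groups. -/

/-- Truncation to the first `M` Fock amplitudes. -/
def trunc (M : ℕ) : Fock →ₗ[ℂ] FiniteFock where
  toFun x := ∑ j ∈ Finset.range M, Finsupp.single j (x j)
  map_add' x y := by simp [Finset.sum_add_distrib]
  map_smul' z x := by simp [Finset.smul_sum]

lemma trunc_apply (M : ℕ) (x : Fock) :
    trunc M x = ∑ j ∈ Finset.range M, Finsupp.single j (x j) := rfl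

lemma trunc_single (M j : ℕ) (z : ℂ) :
    trunc M (incl (Finsupp.single j z)) = if j < M then Finsupp.single j z else 0 := by
  rw [trunc_apply]
  simp only [incl_apply]
  split_ifs with h
  · rw [Finset.sum_eq_single j] <;> simp +contextual [h, eq_comm]
  · refine Finset.sum_eq_zero fun i hi => ?_
    have : j ≠ i := by rintro rfl; exact h (Finset.mem_range.1 hi)
    simp [this]

lemma eventually_trunc_incl (v : FiniteFock) : ∀ᶠ M in atTop, trunc M (incl v) = v := by
  induction v using Finsupp.induction_linear with
  | zero => simp
  | add f g hf hg =>
    filter_upwards [hf, hg] with M h1 h2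
    rw [map_add, map_add, h1, h2]
  | single j z =>
    filter_upwards [eventually_gt_atTop j] with M hM
    rw [trunc_single, if_pos hM]

lemma inner_incl_trunc (M : ℕ) (x y : Fock) :
    inner ℂ (incl (trunc M x)) y = inner ℂ x (incl (trunc M y)) := by
  simp only [trunc_apply, map_sum, incl_single, sum_inner, inner_sum, inner_smul_left,
    inner_smul_right, inner_ket]
  refine Finset.sum_congr rfl fun j _ => ?_
  rw [← inner_conj_symm, inner_ket, mul_comm]

/-- The compression of `A` to the first `M` levels, on the finite vectors. -/
def truncEnd (A : Module.End ℂ FiniteFock) (M : ℕ) : Module.End ℂ FiniteFock :=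
  trunc M ∘ₗ incl ∘ₗ A ∘ₗ trunc M ∘ₗ incl

/-- The compression of `A` to the first `M` levels, as a bounded operator. -/
def truncOp (A : Module.End ℂ FiniteFock) (M : ℕ) : Fock →L[ℂ] Fock :=
  ∑ j ∈ Finset.range M,
    InnerProductSpace.rankOne ℂ (incl (trunc M (incl (A (Finsupp.single j 1))))) (ket j)

lemma truncOp_apply (A : Module.End ℂ FiniteFock) (M : ℕ) (x : Fock) :
    truncOp A M x = incl (trunc M (incl (A (trunc M x)))) := by
  conv_rhs => rw [trunc_apply M x]
  simp only [truncOp, sum_apply, InnerProductSpace.rankOne_apply, inner_ket,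
    map_sum]
  refine Finset.sum_congr rfl fun j _ => ?_
  have : Finsupp.single j (x j) = x j • Finsupp.single j (1 : ℂ) := by simp
  rw [this]
  simp only [map_smul]

lemma truncOp_incl (A : Module.End ℂ FiniteFock) (M : ℕ) (v : FiniteFock) :
    truncOp A M (incl v) = incl (truncEnd A M v) := truncOp_apply A M _

lemma truncOp_pow_incl (A : Module.End ℂ FiniteFock) (M n : ℕ) (v : FiniteFock) :
    (truncOp A M ^ n) (incl v) = incl ((truncEnd A M ^ n) v) := by
  induction n generalizing v with
  | zero => simp
  | succ n ih =>
    rw [pow_succ, pow_succ, mul_apply_eq_comp, Module.End.mul_apply, truncOp_incl, ih]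

lemma eventually_truncEnd_pow (A : Module.End ℂ FiniteFock) (n : ℕ) (v : FiniteFock) :
    ∀ᶠ M in atTop, (truncEnd A M ^ n) v = (A ^ n) v := by
  induction n with
  | zero => simp
  | succ n ih =>
    filter_upwards [ih, eventually_trunc_incl ((A ^ n) v), eventually_trunc_incl ((A ^ (n + 1)) v)]
      with M h1 h2 h3
    rw [pow_succ', Module.End.mul_apply] at h3
    rw [pow_succ', pow_succ', Module.End.mul_apply, Module.End.mul_apply, h1]
    simp only [truncEnd, LinearMap.comp_apply]
    rw [h2, h3]

/-- Compression only deletes matrix entries. Keeping the same d and c makes the growth bounds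
uniform in M. -/
lemma IsBanded.truncEnd {d : ℕ} {c : ℝ} (hc : 0 ≤ c) {A : Module.End ℂ FiniteFock}
    (hA : IsBanded d c A) (M : ℕ) : IsBanded d c (truncEnd A M) := fun k => by
  obtain ⟨x, y, hxy, hx, hy⟩ := hA k
  refine ⟨if k < M ∧ k + d < M then x else 0, if k < M ∧ k - d < M then y else 0, ?_, ?_, ?_⟩
  · simp only [SingleMode.truncEnd, LinearMap.comp_apply, trunc_single]
    by_cases h : k < M
    · simp only [h, if_true, hxy, map_add, trunc_single, true_and]
      split_ifs <;> simp
    · simp [h]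
  · split_ifs
    · exact hx
    · simp only [norm_zero]; positivity
  · split_ifs
    · exact hy
    · simp only [norm_zero]; positivity

lemma IsFormallySkew.truncOp_mem_skewAdjoint {A : Module.End ℂ FiniteFock} (hA : IsFormallySkew A)
    (M : ℕ) : truncOp A M ∈ skewAdjoint (Fock →L[ℂ] Fock) := by
  rw [skewAdjoint.mem_iff, ContinuousLinearMap.star_eq_adjoint, eq_comm,
    ContinuousLinearMap.eq_adjoint_iff]
  intro x y
  simp only [neg_apply, truncOp_apply, inner_neg_left]
  rw [inner_incl_trunc, hA, neg_neg, inner_incl_trunc]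

/-- The unitary groups generated by the compressions of `A`. -/
def truncGroup (A : Module.End ℂ FiniteFock) (M : ℕ) (t : ℝ) : Fock →L[ℂ] Fock :=
  NormedSpace.exp ((t : ℂ) • truncOp A M)

lemma truncGroup_add (A : Module.End ℂ FiniteFock) (M : ℕ) (s t : ℝ) :
    truncGroup A M (s + t) = truncGroup A M s * truncGroup A M t := by
  let +nondep : NormedAlgebra ℚ (Fock →L[ℂ] Fock) := .restrictScalars ℚ ℂ _
  simp only [truncGroup]
  rw [← NormedSpace.exp_add_of_commute, ← add_smul, Complex.ofReal_add]
  exact ((Commute.refl (truncOp A M)).smul_left _).smul_right _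

lemma truncGroup_zero (A : Module.End ℂ FiniteFock) (M : ℕ) : truncGroup A M 0 = 1 := by
  simp [truncGroup]

lemma IsFormallySkew.truncGroup_mem_unitary {A : Module.End ℂ FiniteFock} (hA : IsFormallySkew A)
    (M : ℕ) (t : ℝ) : truncGroup A M t ∈ unitary (Fock →L[ℂ] Fock) := by
  let +nondep : NormedAlgebra ℚ (Fock →L[ℂ] Fock) := .restrictScalars ℚ ℂ _
  refine NormedSpace.exp_mem_unitary_of_mem_skewAdjoint ?_
  have := hA.truncOp_mem_skewAdjoint M
  rw [skewAdjoint.mem_iff] at this ⊢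
  rw [star_smul, this, smul_neg]
  simp

open scoped Nat in
lemma hasSum_truncGroup (A : Module.End ℂ FiniteFock) (M : ℕ) (t : ℝ) (v : FiniteFock) :
    HasSum (fun n : ℕ => t ^ n • ((n ! : ℝ)⁻¹ • incl ((truncEnd A M ^ n) v)))
      (truncGroup A M t (incl v)) := by
  have h := NormedSpace.exp_series_hasSum_exp' (𝕂 := ℝ) ((t : ℂ) • truncOp A M)
  have := h.mapL (ContinuousLinearMap.apply ℂ Fock (incl v))
  have e : ∀ n : ℕ, t ^ n • ((n ! : ℝ)⁻¹ • incl ((truncEnd A M ^ n) v)) =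
      ContinuousLinearMap.apply ℂ Fock (incl v) ((n ! : ℝ)⁻¹ • ((t : ℂ) • truncOp A M) ^ n) := by
    intro n
    rw [ContinuousLinearMap.apply_apply, smul_pow, ← Complex.ofReal_pow, Complex.coe_smul,
      smul_comm, ← truncOp_pow_incl]
    rfl
  simp only [e]
  exact this

lemma norm_apply_of_mem_unitary {U : Fock →L[ℂ] Fock} (hU : U ∈ unitary (Fock →L[ℂ] Fock))
    (x : Fock) : ‖U x‖ = ‖x‖ :=
  ((ContinuousLinearMap.norm_map_iff_adjoint_comp_self U).2 hU.1) x

/-- The seminorm `v ↦ ‖B v‖` on the finite vectors. -/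
def inclSeminorm (B : Module.End ℂ FiniteFock) : Seminorm ℂ FiniteFock :=
  (normSeminorm ℂ Fock).comp (incl ∘ₗ B)

lemma inclSeminorm_apply (B : Module.End ℂ FiniteFock) (v : FiniteFock) :
    inclSeminorm B v = ‖incl (B v)‖ := rfl

lemma inclSeminorm_one_single_le (j : ℕ) :
    inclSeminorm 1 (Finsupp.single j (1 : ℂ)) ≤ j + 1 := by
  simp [inclSeminorm_apply, incl_single]

open scoped Nat in
lemma exists_norm_pow_le {d : ℕ} {c : ℝ} (hd : d ≤ 2) (hc : 0 ≤ c) (v : FiniteFock) :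
    ∃ C, 0 ≤ C ∧ ∀ T, IsBanded d c T → ∀ n : ℕ, ‖incl ((T ^ n) v)‖ ≤ C * (32 * c) ^ n * n ! :=
  exists_seminorm_pow_le hd hc (inclSeminorm 1) inclSeminorm_one_single_le v

/-! ### Existence of the unitary group. -/

-- Dominated convergence in the exponential series: each term is eventually constant in M, and the
-- uniform growth bound supplies a geometric majorant when |t| is small.
open scoped Nat in
lemma tendsto_truncGroup_incl {d : ℕ} {c : ℝ} (hd : d ≤ 2) (hc : 0 ≤ c)
    {A : Module.End ℂ FiniteFock} (hA : IsBanded d c A) {t : ℝ} (ht : |t| * (32 * c) < 1)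
    (v : FiniteFock) : ∃ y, HasSum (fun n : ℕ => t ^ n • ((n ! : ℝ)⁻¹ • incl ((A ^ n) v))) y ∧
      Tendsto (fun M => truncGroup A M t (incl v)) atTop (𝓝 y) := by
  obtain ⟨C, hC, h⟩ := exists_norm_pow_le hd hc v
  have hbound : ∀ T, IsBanded d c T → ∀ n : ℕ, ‖t ^ n • ((n ! : ℝ)⁻¹ • incl ((T ^ n) v))‖ ≤
      C * (|t| * (32 * c)) ^ n := by
    intro T hT n
    rw [norm_smul, norm_smul, norm_pow, norm_inv, Real.norm_eq_abs, Real.norm_natCast]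
    calc |t| ^ n * ((n ! : ℝ)⁻¹ * ‖incl ((T ^ n) v)‖)
        ≤ |t| ^ n * ((n ! : ℝ)⁻¹ * (C * (32 * c) ^ n * n !)) := by gcongr; exact h T hT n
      _ = C * (|t| * (32 * c)) ^ n := by
        rw [mul_pow |t|]; field_simp
  have hs : Summable fun n : ℕ => C * (|t| * (32 * c)) ^ n :=
    (summable_geometric_of_lt_one (by positivity) ht).mul_left C
  have hsum : Summable fun n : ℕ => t ^ n • ((n ! : ℝ)⁻¹ • incl ((A ^ n) v)) :=
    Summable.of_norm_bounded hs (hbound A hA)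
  refine ⟨_, hsum.hasSum, ?_⟩
  simp only [← (hasSum_truncGroup A _ t v).tsum_eq]
  refine tendsto_tsum_of_dominated_convergence hs (fun n => ?_)
    (Eventually.of_forall fun M n => hbound _ (hA.truncEnd hc M) n)
  refine tendsto_const_nhds.congr' ?_
  filter_upwards [eventually_truncEnd_pow A n v] with M hM
  rw [hM]

lemma exists_tendsto_of_incl {U : ℕ → Fock →L[ℂ] Fock} (hU : ∀ M x, ‖U M x‖ = ‖x‖)
    (h : ∀ v, ∃ y, Tendsto (fun M => U M (incl v)) atTop (𝓝 y)) (x : Fock) :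
    ∃ y, Tendsto (fun M => U M x) atTop (𝓝 y) := by
  refine cauchySeq_tendsto_of_complete (Metric.cauchySeq_iff'.2 fun ε hε => ?_)
  obtain ⟨v, hv⟩ := denseRange_incl.exists_dist_lt x (show 0 < ε / 3 by positivity)
  obtain ⟨y, hy⟩ := h v
  obtain ⟨N, hN⟩ := Metric.cauchySeq_iff'.1 hy.cauchySeq (ε / 3) (by positivity)
  have key : ∀ M, dist (U M x) (U M (incl v)) < ε / 3 := fun M => by
    rw [dist_eq_norm, ← map_sub, hU, ← dist_eq_norm]; exact hv
  refine ⟨N, fun M hM => ?_⟩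
  calc dist (U M x) (U N x) ≤ dist (U M x) (U M (incl v)) + dist (U M (incl v)) (U N (incl v))
        + dist (U N (incl v)) (U N x) := dist_triangle4 _ _ _ _
    _ < ε / 3 + ε / 3 + ε / 3 := by
        have := key N
        rw [dist_comm] at this
        gcongr
        · exact key M
        · exact hN M hM
    _ = ε := by ring

lemma tendsto_mul_apply {U V : ℕ → Fock →L[ℂ] Fock} (hU : ∀ M x, ‖U M x‖ = ‖x‖) {x y z : Fock}
    (hV : Tendsto (fun M => V M x) atTop (𝓝 y)) (hUy : Tendsto (fun M => U M y) atTop (𝓝 z)) :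
    Tendsto (fun M => (U M * V M) x) atTop (𝓝 z) := by
  have h0 : Tendsto (fun M => U M (V M x - y)) atTop (𝓝 0) := by
    rw [tendsto_zero_iff_norm_tendsto_zero]
    simp only [hU]
    simpa using (hV.sub_const y).norm
  simpa using h0.add hUy

lemma exists_tendsto_truncGroup {d : ℕ} {c : ℝ} (hd : d ≤ 2) (hc : 0 ≤ c)
    {A : Module.End ℂ FiniteFock} (hA : IsBanded d c A) (hskew : IsFormallySkew A) (t : ℝ)
    (x : Fock) : ∃ y, Tendsto (fun M => truncGroup A M t x) atTop (𝓝 y) := by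
  have hU : ∀ t M x, ‖truncGroup A M t x‖ = ‖x‖ := fun t M =>
    norm_apply_of_mem_unitary (hskew.truncGroup_mem_unitary M t)
  -- The series converges only for short times, so t is split into m equal steps inside the radius
  -- and the group law composes the limits.
  obtain ⟨m, hm⟩ := exists_nat_gt (|t| * (32 * c))
  have hm0 : (0 : ℝ) < m := lt_of_le_of_lt (by positivity) hm
  have small : ∀ x, ∃ y, Tendsto (fun M => truncGroup A M (t / m) x) atTop (𝓝 y) := by
    refine exists_tendsto_of_incl (hU _) fun v => ?_
    obtain ⟨y, -, hy⟩ := tendsto_truncGroup_incl hd hc hA (t := t / m) (by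
      rw [abs_div, abs_of_pos hm0, div_mul_eq_mul_div, div_lt_one hm0]; exact hm) v
    exact ⟨y, hy⟩
  have mult : ∀ k : ℕ, ∀ x, ∃ y, Tendsto (fun M => truncGroup A M (k * (t / m)) x) atTop (𝓝 y) := by
    intro k
    induction k with
    | zero => intro x; exact ⟨x, by simp [truncGroup_zero]⟩
    | succ k ih =>
      intro x
      obtain ⟨y, hy⟩ := small x
      obtain ⟨z, hz⟩ := ih y
      refine ⟨z, ?_⟩
      have := tendsto_mul_apply (hU _) hy hz
      simp only [← truncGroup_add] at this
      convert this using 4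
      push_cast; ring
  have := mult m x
  rwa [mul_div_cancel₀ t hm0.ne'] at this

/-- A formally skew-adjoint banded operator whose matrix entries grow at most linearly
generates a unitary group. -/
theorem exists_isUnitaryGroupOf {d : ℕ} {c : ℝ} (hd : d ≤ 2) (hc : 0 ≤ c)
    {A : Module.End ℂ FiniteFock} (hA : IsBanded d c A) (hskew : IsFormallySkew A) :
    ∃ U, IsUnitaryGroupOf A U := by
  have hN : ∀ t M x, ‖truncGroup A M t x‖ = ‖x‖ := fun t M =>
    norm_apply_of_mem_unitary (hskew.truncGroup_mem_unitary M t)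
  choose f hf using exists_tendsto_truncGroup hd hc hA hskew
  let U : ℝ → Fock →L[ℂ] Fock := fun t =>
    continuousLinearMapOfTendsto (fun M => truncGroup A M t) (f := f t)
      (tendsto_pi_nhds.2 (hf t))
  have hU : ∀ t x, Tendsto (fun M => truncGroup A M t x) atTop (𝓝 (U t x)) := hf
  have hnorm : ∀ t x, ‖U t x‖ = ‖x‖ := fun t x => by
    refine tendsto_nhds_unique (hU t x).norm ?_
    simp only [hN]
    exact tendsto_const_nhds
  have hzero : U 0 = 1 := by
    ext1 x
    refine tendsto_nhds_unique (hU 0 x) ?_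
    simp [truncGroup_zero]
  have hadd : ∀ s t, U (s + t) = U s * U t := fun s t => by
    ext1 x
    refine tendsto_nhds_unique (hU (s + t) x) ?_
    simp only [truncGroup_add]
    exact tendsto_mul_apply (hN s) (hU t x) (hU s (U t x))
  have hgen : ∀ v, HasDerivAt (fun t => U t (incl v)) (incl (A v)) 0 := by
    intro v
    -- Near 0 the orbit of a finite vector is its exponential series; the linear coefficient A v is
    -- the derivative.
    let p : FormalMultilinearSeries ℝ ℝ Fock := fun n =>
      ContinuousMultilinearMap.mkPiRing ℝ (Fin n) ((n.factorial : ℝ)⁻¹ • incl ((A ^ n) v))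
    have hp : HasFPowerSeriesAt (fun t => U t (incl v)) p 0 := by
      rw [hasFPowerSeriesAt_iff]
      have hcont : ContinuousAt (fun t : ℝ => |t| * (32 * c)) 0 := by fun_prop
      have : ∀ᶠ t : ℝ in 𝓝 0, |t| * (32 * c) < 1 :=
        hcont.tendsto.eventually_lt_const (by simp)
      filter_upwards [this] with t ht
      obtain ⟨y, hy, hy'⟩ := tendsto_truncGroup_incl hd hc hA ht v
      rw [zero_add, tendsto_nhds_unique (hU t (incl v)) hy']
      simpa [p, FormalMultilinearSeries.coeff] using hy
    simpa [p] using hp.hasDerivAt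
  have hcont0 : ∀ x, Tendsto (fun t => U t x) (𝓝 0) (𝓝 x) := by
    intro x
    refine Metric.tendsto_nhds.2 fun ε hε => ?_
    obtain ⟨v, hv⟩ := denseRange_incl.exists_dist_lt x (show 0 < ε / 3 by positivity)
    have h1 := (hgen v).continuousAt.tendsto
    rw [hzero] at h1
    filter_upwards [Metric.tendsto_nhds.1 h1 (ε / 3) (by positivity)] with t ht
    calc dist (U t x) x ≤ dist (U t x) (U t (incl v)) + dist (U t (incl v)) (incl v)
          + dist (incl v) x := dist_triangle4 _ _ _ _
      _ < ε / 3 + ε / 3 + ε / 3 := by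
          gcongr
          · rw [dist_eq_norm, ← map_sub, hnorm, ← dist_eq_norm]; exact hv
          · exact ht
          · rw [dist_comm]; exact hv
      _ = ε := by ring
  refine ⟨U, ⟨fun t => ?_, hzero, hadd, fun x => ?_, hgen⟩⟩
  -- A strong limit of unitaries is a priori only isometric; surjectivity comes from the inverse U
  -- (-t).
  · have h1 : ContinuousLinearMap.adjoint (U t) * U t = 1 :=
      (ContinuousLinearMap.norm_map_iff_adjoint_comp_self (U t)).1 (hnorm t)
    have h2 : U t * U (-t) = 1 := by rw [← hadd, add_neg_cancel, hzero]
    refine ⟨h1, ?_⟩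
    rw [ContinuousLinearMap.star_eq_adjoint, left_inv_eq_right_inv h1 h2, h2]
  · refine continuous_iff_continuousAt.2 fun t => ?_
    have h1 : Tendsto (fun s => U (s - t) x) (𝓝 t) (𝓝 x) :=
      (hcont0 x).comp (by simpa using (continuous_sub_right t).tendsto t)
    have h2 := ((U t).continuous.tendsto x).comp h1
    have h3 : (⇑(U t) ∘ fun s => U (s - t) x) = fun s => U s x := by
      ext1 s
      rw [Function.comp_apply, ← mul_apply_eq_comp, ← hadd, add_sub_cancel]
    rw [h3] at h2
    exact h2

/-! ### Uniqueness of the unitary group. -/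

section Uniqueness

variable {A : Module.End ℂ FiniteFock} {U : ℝ → Fock →L[ℂ] Fock}

lemma IsUnitaryGroupOf.hasDerivAt (hU : IsUnitaryGroupOf A U) (v : FiniteFock) (t : ℝ) :
    HasDerivAt (fun t => U t (incl v)) (U t (incl (A v))) t := by
  have h1 : HasDerivAt (fun s => U (s - t) (incl v)) (incl (A v)) t :=
    HasDerivAt.comp_sub_const t t (by simpa using hU.generator v)
  have h2 := (((U t).restrictScalars ℝ).hasFDerivAt).comp_hasDerivAt t h1
  have h3 : (⇑((U t).restrictScalars ℝ) ∘ fun s => U (s - t) (incl v)) =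
      fun s => U s (incl v) := by
    ext1 s
    rw [Function.comp_apply, ContinuousLinearMap.coe_restrictScalars', ← mul_apply_eq_comp,
      ← hU.add, add_sub_cancel]
  rw [h3] at h2
  exact h2

lemma IsUnitaryGroupOf.norm_apply (hU : IsUnitaryGroupOf A U) (t : ℝ) (x : Fock) :
    ‖U t x‖ = ‖x‖ := norm_apply_of_mem_unitary (hU.unitary t) x

lemma IsUnitaryGroupOf.neg_eq_adjoint (hU : IsUnitaryGroupOf A U) (t : ℝ) :
    U (-t) = ContinuousLinearMap.adjoint (U t) := by
  have h2 : U t * U (-t) = 1 := by rw [← hU.add, add_neg_cancel, hU.zero]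
  exact (left_inv_eq_right_inv (hU.unitary t).1 h2).symm

theorem IsUnitaryGroupOf.unique {d : ℕ} {c : ℝ} (hd : d ≤ 2) (hc : 0 ≤ c) (hA : IsBanded d c A)
    {V : ℝ → Fock →L[ℂ] Fock} (hU : IsUnitaryGroupOf A U) (hV : IsUnitaryGroupOf A V) :
    U = V := by
  have pos : ∀ t, 0 ≤ t → U t = V t := by
    intro t ht
    ext1 x
    refine ext_incl (U t).continuous (V t).continuous (fun v => ?_) x
    rw [← sub_eq_zero]
    refine eq_zero_of_hasDerivAt A (fun v t => U t (incl v) - V t (incl v))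
      (fun v t => (hU.hasDerivAt v t).sub (hV.hasDerivAt v t)) (by simp [hU.zero, hV.zero])
      (K := 32 * c) (by positivity) (fun T v => ?_) v ht
    obtain ⟨C, -, h⟩ := exists_norm_pow_le hd hc v
    refine ⟨2 * C, fun n t _ => (norm_sub_le _ _).trans ?_⟩
    rw [hU.norm_apply, hV.norm_apply]
    linarith [h A hA n]
  ext1 t
  rcases le_total 0 t with h | h
  · exact pos t h
  · have := pos (-t) (by linarith)
    rw [← neg_neg t, hU.neg_eq_adjoint, hV.neg_eq_adjoint, this]

/-- Uniqueness selects the first branch of `unitaryExp`, so its default value 0 never occurs for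
these exponents. -/
lemma unitaryExp_eq {d : ℕ} {c : ℝ} (hd : d ≤ 2) (hc : 0 ≤ c) (hA : IsBanded d c A)
    (hU : IsUnitaryGroupOf A U) : unitaryExp A = U 1 := by
  have h : ∃! U, IsUnitaryGroupOf A U := ⟨U, hU, fun V hV => hV.unique hd hc hA hU⟩
  rw [unitaryExp, dif_pos h, hU.unique hd hc hA h.choose_spec.1]

end Uniqueness

/-! ### Heisenberg evolution of the ladder operators. -/

lemma inclSeminorm_annihilation_single_le (j : ℕ) :
    inclSeminorm annihilation (Finsupp.single j (1 : ℂ)) ≤ j + 1 := by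
  rw [inclSeminorm_apply, annihilation_single, incl_single, norm_smul, norm_ket, one_mul, mul_one,
    Complex.norm_real, Real.norm_of_nonneg (Real.sqrt_nonneg _)]
  exact Real.sqrt_le_iff.2 ⟨by positivity, by nlinarith⟩

lemma inclSeminorm_creation_single_le (j : ℕ) :
    inclSeminorm creation (Finsupp.single j (1 : ℂ)) ≤ j + 1 := by
  rw [inclSeminorm_apply, creation_single, incl_single, norm_smul, norm_ket, one_mul, mul_one,
    Complex.norm_real, Real.norm_of_nonneg (Real.sqrt_nonneg _)]
  exact Real.sqrt_le_iff.2 ⟨by positivity, by nlinarith⟩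

/-- The Heisenberg evolution of a ladder operator under a unitary group, in weak form. -/
theorem IsUnitaryGroupOf.inner_eq {A : Module.End ℂ FiniteFock} {U : ℝ → Fock →L[ℂ] Fock}
    (hU : IsUnitaryGroupOf A U) {d : ℕ} {c : ℝ} (hd : d ≤ 2) (hc : 0 ≤ c) (hA : IsBanded d c A)
    {X X' : Module.End ℂ FiniteFock} (hX : IsFormalAdjoint X' X) {f g h f' g' h' : ℝ → ℂ}
    (hf : ∀ t, HasDerivAt f (f' t) t) (hg : ∀ t, HasDerivAt g (g' t) t)
    (hh : ∀ t, HasDerivAt h (h' t) t)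
    (h0 : f 0 • annihilation + g 0 • creation + h 0 • 1 = X)
    (hY : ∀ t, f' t • annihilation + g' t • creation + h' t • 1 =
      (f t • annihilation + g t • creation + h t • 1) * A -
        A * (f t • annihilation + g t • creation + h t • 1))
    (v w : FiniteFock) {t : ℝ} (ht : 0 ≤ t) :
    inner ℂ (incl (X' w)) (U t (incl v)) = inner ℂ (incl w)
      (U t (incl ((f t • annihilation + g t • creation + h t • (1 : Module.End ℂ FiniteFock)) v))) := by
  -- With Y_t = f a + g a† + h, the claim is X U_t = U_t Y_t. It is tested against w because U_t v
  -- need not be a finite vector. Since Y' = Y A − A Y, the difference G of the two sides satisfies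
  -- (G v)' = G (A v) and G v 0 = 0.
  let φ : ℝ → FiniteFock →ₗ[ℂ] ℂ := fun t => (innerSL ℂ (incl w)).toLinearMap ∘ₗ
    (U t).toLinearMap ∘ₗ incl
  have hφ : ∀ t u, φ t u = inner ℂ (incl w) (U t (incl u)) := fun t u => rfl
  have hφ' : ∀ u t, HasDerivAt (fun t => φ t u) (φ t (A u)) t := fun u t =>
    (((innerSL ℂ (incl w)).restrictScalars ℝ).hasFDerivAt).comp_hasDerivAt t (hU.hasDerivAt u t)
  have hφn : ∀ t u, ‖φ t u‖ ≤ ‖incl w‖ * ‖incl u‖ := fun t u => by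
    rw [hφ]
    exact (norm_inner_le_norm _ _).trans_eq (by rw [hU.norm_apply])
  have hψ' : ∀ u t, HasDerivAt (fun t => inner ℂ (incl (X' w)) (U t (incl u)))
      (inner ℂ (incl (X' w)) (U t (incl (A u)))) t := fun u t =>
    (((innerSL ℂ (incl (X' w))).restrictScalars ℝ).hasFDerivAt).comp_hasDerivAt t
      (hU.hasDerivAt u t)
  have hψn : ∀ t u, ‖inner ℂ (incl (X' w)) (U t (incl u))‖ ≤ ‖incl (X' w)‖ * ‖incl u‖ :=
    fun t u => (norm_inner_le_norm _ _).trans_eq (by rw [hU.norm_apply])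
  have expand : ∀ t u, φ t ((f t • annihilation + g t • creation +
      h t • (1 : Module.End ℂ FiniteFock)) u) =
      f t * φ t (annihilation u) + g t * φ t (creation u) + h t * φ t u := fun t u => by
    simp
  rw [← hφ, expand, ← sub_eq_zero]
  refine eq_zero_of_hasDerivAt A (fun v t => inner ℂ (incl (X' w)) (U t (incl v)) -
    (f t * φ t (annihilation v) + g t * φ t (creation v) + h t * φ t v))
    (fun v t => ?_) (fun v => ?_) (K := 32 * c) (by positivity) (fun T v => ?_) v ht
  · refine ((hψ' v t).sub ((((hf t).mul (hφ' (annihilation v) t)).add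
      ((hg t).mul (hφ' (creation v) t))).add ((hh t).mul (hφ' v t)))).congr_deriv ?_
    have := congrArg (φ t) (LinearMap.congr_fun (hY t) v)
    simp only [LinearMap.add_apply, LinearMap.sub_apply, LinearMap.smul_apply, map_add, map_sub,
      map_smul, Module.End.mul_apply, Module.End.one_apply, smul_eq_mul] at this
    linear_combination -this
  · rw [← expand, h0, hφ, hU.zero]
    simp [hX w v]
  · obtain ⟨C1, hC1, b1⟩ := exists_norm_pow_le hd hc v
    obtain ⟨C2, hC2, b2⟩ := exists_seminorm_pow_le hd hc (inclSeminorm annihilation)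
      inclSeminorm_annihilation_single_le v
    obtain ⟨C3, hC3, b3⟩ := exists_seminorm_pow_le hd hc (inclSeminorm creation)
      inclSeminorm_creation_single_le v
    have bdd : ∀ f f' : ℝ → ℂ, (∀ t, HasDerivAt f (f' t) t) →
        ∃ M, 0 ≤ M ∧ ∀ t ∈ Set.Icc 0 T, ‖f t‖ ≤ M := fun f f' hf => by
      obtain ⟨M, hM⟩ := isCompact_Icc.exists_bound_of_continuousOn (s := Set.Icc 0 T) (f := f)
        fun t _ => (hf t).continuousAt.continuousWithinAt
      exact ⟨max M 0, le_max_right _ _, fun t ht => (hM t ht).trans (le_max_left _ _)⟩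
    obtain ⟨F, hF, hF'⟩ := bdd f f' hf
    obtain ⟨G, hG, hG'⟩ := bdd g g' hg
    obtain ⟨H, hH, hH'⟩ := bdd h h' hh
    refine ⟨‖incl (X' w)‖ * C1 + (F * (‖incl w‖ * C2) + G * (‖incl w‖ * C3) +
      H * (‖incl w‖ * C1)), fun n t ht => ?_⟩
    have c1 := b1 A hA n
    have c2 := b2 A hA n
    have c3 := b3 A hA n
    rw [inclSeminorm_apply] at c2 c3
    refine (norm_sub_le _ _).trans ((add_le_add_right (norm_add₃_le) _).trans ?_)
    simp only [norm_mul]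
    have := hF' t ht
    have := hG' t ht
    have := hH' t ht
    calc _ ≤ ‖incl (X' w)‖ * (C1 * (32 * c) ^ n * n.factorial) +
          (F * (‖incl w‖ * (C2 * (32 * c) ^ n * n.factorial)) +
            G * (‖incl w‖ * (C3 * (32 * c) ^ n * n.factorial)) +
            H * (‖incl w‖ * (C1 * (32 * c) ^ n * n.factorial))) := by
          gcongr
          · exact (hψn _ _).trans (by gcongr)
          · exact (hφn _ _).trans (by gcongr)
          · exact (hφn _ _).trans (by gcongr)
          · exact (hφn _ _).trans (by gcongr)
      _ = _ := by ring

lemma end_sub_eq (A B : Module.End ℂ FiniteFock) : A - B = A + (-1 : ℂ) • B := by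
  ext1 n
  ext1
  simp [sub_eq_add_neg]

lemma annihilation_mul_creation :
    annihilation * creation = creation * annihilation + 1 := by
  ext1 n
  ext1
  simp only [LinearMap.comp_apply, Finsupp.lsingle_apply, Module.End.mul_apply, LinearMap.add_apply,
    Module.End.one_apply, creation_single, annihilation_single, one_mul, Nat.add_sub_cancel]
  rcases n with _ | n
  · simp
  · simp only [Nat.add_sub_cancel]
    rw [← Finsupp.single_add]
    congr 1
    push_cast
    rw [← Complex.ofReal_mul, ← Complex.ofReal_mul, Real.mul_self_sqrt (by positivity),
      Real.mul_self_sqrt (by positivity)]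
    push_cast
    ring

lemma annihilation_mul_creation_sq :
    annihilation * creation ^ 2 = creation ^ 2 * annihilation + (2 : ℂ) • creation := by
  rw [pow_two, ← mul_assoc, annihilation_mul_creation, add_mul, mul_assoc,
    annihilation_mul_creation, one_mul, mul_add, mul_one, mul_assoc, two_smul, add_assoc]

lemma annihilation_sq_mul_creation :
    annihilation ^ 2 * creation = creation * annihilation ^ 2 + (2 : ℂ) • annihilation := by
  rw [pow_two, mul_assoc, annihilation_mul_creation, mul_add, mul_one, ← mul_assoc,
    annihilation_mul_creation, add_mul, one_mul, mul_assoc, two_smul, add_assoc]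

lemma exists_displacement (β : ℂ) : ∃ U,
    IsUnitaryGroupOf (β • creation - (starRingEnd ℂ β) • annihilation) U ∧
      displacement β = U 1 := by
  obtain ⟨U, hU⟩ := exists_isUnitaryGroupOf (by norm_num) (norm_nonneg _)
    (isBanded_displacement β) (isFormalAdjoint_annihilation.isFormallySkew β)
  exact ⟨U, hU, unitaryExp_eq (by norm_num) (norm_nonneg _) (isBanded_displacement β) hU⟩

lemma displacement_mem_unitary (β : ℂ) : displacement β ∈ unitary (Fock →L[ℂ] Fock) := by
  obtain ⟨U, hU, h⟩ := exists_displacement β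
  exact h ▸ hU.unitary 1

/-- The weak form of D† a D = a + β: the commutator of a with the exponent is the scalar β, so Y_t =
a + tβ. -/
lemma inner_creation_displacement (β : ℂ) (v w : FiniteFock) :
    inner ℂ (incl (creation w)) (displacement β (incl v)) =
      inner ℂ (incl w) (displacement β (incl (annihilation v + β • v))) := by
  obtain ⟨U, hU, h⟩ := exists_displacement β
  rw [h, hU.inner_eq (by norm_num) (norm_nonneg _) (isBanded_displacement β)
    isFormalAdjoint_annihilation.symm (f := fun _ => 1) (g := fun _ => 0) (h := fun t => t * β)
    (f' := fun _ => 0) (g' := fun _ => 0) (h' := fun _ => β) (fun t => hasDerivAt_const _ _)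
    (fun t => hasDerivAt_const _ _)
    (fun t => by simpa using (hasDerivAt_id t).ofReal_comp.mul_const β) (by simp) (fun t => ?_)
    v w zero_le_one]
  · simp
  · simp only [zero_smul, one_smul, add_zero, zero_add, end_sub_eq, add_mul, mul_add,
      smul_mul_assoc, mul_smul_comm, one_mul, mul_one, annihilation_mul_creation]
    module

lemma inner_annihilation_displacement (β : ℂ) (v w : FiniteFock) :
    inner ℂ (incl (annihilation w)) (displacement β (incl v)) =
      inner ℂ (incl w) (displacement β (incl (creation v + starRingEnd ℂ β • v))) := by
  obtain ⟨U, hU, h⟩ := exists_displacement β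
  rw [h, hU.inner_eq (by norm_num) (norm_nonneg _) (isBanded_displacement β)
    isFormalAdjoint_annihilation (f := fun _ => 0) (g := fun _ => 1)
    (h := fun t => t * starRingEnd ℂ β)
    (f' := fun _ => 0) (g' := fun _ => 0) (h' := fun _ => starRingEnd ℂ β)
    (fun t => hasDerivAt_const _ _) (fun t => hasDerivAt_const _ _)
    (fun t => by simpa using (hasDerivAt_id t).ofReal_comp.mul_const (starRingEnd ℂ β))
    (by simp) (fun t => ?_) v w zero_le_one]
  · simp
  · simp only [zero_smul, one_smul, add_zero, zero_add, end_sub_eq, add_mul, mul_add,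
      smul_mul_assoc, mul_smul_comm, one_mul, mul_one, annihilation_mul_creation]
    module

lemma exists_squeezing (ξ : ℂ) : ∃ U,
    IsUnitaryGroupOf ((1 / 2 * ξ) • creation ^ 2 - (starRingEnd ℂ (1 / 2 * ξ)) • annihilation ^ 2) U ∧
      squeezing ξ = U 1 := by
  obtain ⟨U, hU⟩ := exists_isUnitaryGroupOf le_rfl (norm_nonneg _) (isBanded_squeezing (1 / 2 * ξ))
    (IsFormalAdjoint.isFormallySkew (by
      rw [pow_two, pow_two]
      exact isFormalAdjoint_annihilation.mul isFormalAdjoint_annihilation) (1 / 2 * ξ))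
  refine ⟨U, hU, ?_⟩
  rw [← unitaryExp_eq le_rfl (norm_nonneg _) (isBanded_squeezing (1 / 2 * ξ)) hU, squeezing,
    map_mul, map_div₀, map_one, map_ofNat]

lemma squeezing_mem_unitary (ξ : ℂ) : squeezing ξ ∈ unitary (Fock →L[ℂ] Fock) := by
  obtain ⟨U, hU, h⟩ := exists_squeezing ξ
  exact h ▸ hU.unitary 1

lemma hasDerivAt_ofReal_cosh (r : ℝ) (z : ℂ) (t : ℝ) :
    HasDerivAt (fun t : ℝ => z * (Real.cosh (r * t) : ℝ)) (z * (r * Real.sinh (r * t) : ℝ)) t := by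
  have := (((hasDerivAt_id t).const_mul r).cosh.ofReal_comp).const_mul z
  simpa [mul_comm, mul_left_comm] using this

lemma hasDerivAt_ofReal_sinh (r : ℝ) (z : ℂ) (t : ℝ) :
    HasDerivAt (fun t : ℝ => z * (Real.sinh (r * t) : ℝ)) (z * (r * Real.cosh (r * t) : ℝ)) t := by
  have := (((hasDerivAt_id t).const_mul r).sinh.ofReal_comp).const_mul z
  simpa [mul_comm, mul_left_comm] using this

/-- The weak form of S† a S = cosh r · a + e sinh r · a†. Commuting with the exponent sends a to r e
a† and a† to r e* a; as |e| = 1, this linear system is solved by cosh and sinh. -/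
lemma inner_creation_squeezing (r : ℝ) {e : ℂ} (he : e * starRingEnd ℂ e = 1) (v w : FiniteFock) :
    inner ℂ (incl (creation w)) (squeezing (r * e) (incl v)) =
      inner ℂ (incl w) (squeezing (r * e) (incl
        ((Real.cosh r : ℂ) • annihilation v + (e * Real.sinh r) • creation v))) := by
  obtain ⟨U, hU, h⟩ := exists_squeezing (r * e)
  rw [h, hU.inner_eq le_rfl (norm_nonneg _) (isBanded_squeezing _)
    isFormalAdjoint_annihilation.symm (h := fun _ => 0) (h' := fun _ => 0)
    (hasDerivAt_ofReal_cosh r 1) (hasDerivAt_ofReal_sinh r e)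
    (fun t => hasDerivAt_const _ _) (by simp) (fun t => ?_) v w zero_le_one]
  · simp
  · simp only [zero_smul, add_zero, end_sub_eq, add_mul, mul_add, annihilation_mul_creation_sq,
      smul_mul_assoc, mul_smul_comm, annihilation_sq_mul_creation, map_mul, map_div₀, map_one, map_ofNat,
      Complex.conj_ofReal,
      ← pow_succ, ← pow_succ', smul_add, smul_smul]
    match_scalars
    · linear_combination (-(r * Complex.sinh (r * t))) * he
    all_goals ring

lemma inner_annihilation_squeezing (r : ℝ) {e : ℂ} (he : e * starRingEnd ℂ e = 1)
    (v w : FiniteFock) :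
    inner ℂ (incl (annihilation w)) (squeezing (r * e) (incl v)) =
      inner ℂ (incl w) (squeezing (r * e) (incl
        ((starRingEnd ℂ e * Real.sinh r) • annihilation v + (Real.cosh r : ℂ) • creation v))) := by
  obtain ⟨U, hU, h⟩ := exists_squeezing (r * e)
  rw [h, hU.inner_eq le_rfl (norm_nonneg _) (isBanded_squeezing _)
    isFormalAdjoint_annihilation (h := fun _ => 0) (h' := fun _ => 0)
    (hasDerivAt_ofReal_sinh r (starRingEnd ℂ e)) (hasDerivAt_ofReal_cosh r 1)
    (fun t => hasDerivAt_const _ _) (by simp) (fun t => ?_) v w zero_le_one]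
  · simp
  · simp only [zero_smul, add_zero, end_sub_eq, add_mul, mul_add, annihilation_mul_creation_sq,
      smul_mul_assoc, mul_smul_comm, annihilation_sq_mul_creation, map_mul, map_div₀, map_one, map_ofNat,
      Complex.conj_ofReal,
      ← pow_succ, ← pow_succ', smul_add, smul_smul]
    match_scalars
    · ring
    · linear_combination (-(r * Complex.sinh (r * t))) * he
    all_goals ring

lemma isUnitaryGroupOf_zero : IsUnitaryGroupOf 0 fun _ => 1 where
  unitary _ := one_mem _
  zero := rfl
  add _ _ := by simp
  continuous _ := by fun_prop
  generator v := by simpa using hasDerivAt_const (0 : ℝ) (incl v)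

lemma unitaryExp_zero : unitaryExp 0 = 1 :=
  unitaryExp_eq (d := 0) (c := 0) (by norm_num) le_rfl (fun k => ⟨0, 0, by simp⟩)
    isUnitaryGroupOf_zero

lemma displacement_zero : displacement 0 = 1 := by
  simp [displacement, end_sub_eq, unitaryExp_zero]

lemma squeezing_zero : squeezing 0 = 1 := by
  simp [squeezing, end_sub_eq, unitaryExp_zero]

/-! ### Comparing number states with the squeezed vacuum. -/

/-- A displaced number state is proportional to a squeezed vacuum only if there is neither
displacement nor squeezing. -/
theorem eq_zero_of_adjoint_displacement_ket {β : ℂ} {r : ℝ} {e : ℂ}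
    (he : e * starRingEnd ℂ e = 1) {m : ℕ} {z : ℂ}
    (h : ContinuousLinearMap.adjoint (displacement β) (ket m) = z • squeezing (r * e) (ket 0)) :
    β = 0 ∧ r = 0 := by
  set D := displacement β
  set S := squeezing (r * e)
  set u : FiniteFock := Finsupp.single m 1 with hu
  have hku : ket m = incl u := by simp [hu, incl_single]
  have hk0 : ket 0 = incl (Finsupp.single 0 1) := by simp [incl_single]
  -- Conjugating the relation for a† and D gives a D† = D† (a − β) in weak form.
  have hc : ∀ w, inner ℂ (incl (creation w)) (ContinuousLinearMap.adjoint D (ket m)) =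
      inner ℂ (incl w) (ContinuousLinearMap.adjoint D (incl (annihilation u - β • u))) := by
    intro w
    have := congrArg (starRingEnd ℂ) (inner_annihilation_displacement β w u)
    simp only [inner_conj_symm, map_add, map_smul, inner_add_left, inner_smul_left,
      Complex.conj_conj] at this
    simp only [ContinuousLinearMap.adjoint_inner_right, hku, map_sub, map_smul, inner_sub_right,
      inner_smul_right]
    linear_combination -this
  have ha : ∀ w, inner ℂ (incl (annihilation w)) (ContinuousLinearMap.adjoint D (ket m)) =
      inner ℂ (incl w)
        (ContinuousLinearMap.adjoint D (incl (creation u - starRingEnd ℂ β • u))) := by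
    intro w
    have := congrArg (starRingEnd ℂ) (inner_creation_displacement β w u)
    simp only [inner_conj_symm, map_add, map_smul, inner_add_left, inner_smul_left] at this
    simp only [ContinuousLinearMap.adjoint_inner_right, hku, map_sub, map_smul, inner_sub_right,
      inner_smul_right]
    linear_combination -this
  -- Since a|0⟩ = 0, both a S|0⟩ and a† S|0⟩ are multiples of S a†|0⟩, with factors e sinh r and
  -- cosh r.
  have hS : ∀ w, (Real.cosh r : ℂ) * inner ℂ (incl (creation w)) (S (ket 0)) =
      (e * Real.sinh r) * inner ℂ (incl (annihilation w)) (S (ket 0)) := by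
    intro w
    rw [hk0, inner_creation_squeezing r he, inner_annihilation_squeezing r he]
    have : annihilation (Finsupp.single 0 1) = 0 := by simp [annihilation_single]
    simp only [this, smul_zero, zero_add, map_smul, inner_smul_right]
    ring
  have hzero : (Real.cosh r : ℂ) • (annihilation u - β • u) -
      (e * Real.sinh r) • (creation u - starRingEnd ℂ β • u) = 0 := by
    apply incl_injective
    have hD : ContinuousLinearMap.adjoint D ∈ unitary (Fock →L[ℂ] Fock) :=
      Unitary.star_mem (displacement_mem_unitary β)
    rw [map_zero, ← norm_eq_zero, ← norm_apply_of_mem_unitary hD, norm_eq_zero]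
    refine denseRange_incl.eq_zero_of_inner_right ℂ fun w => ?_
    have := hS w
    rw [map_sub, map_sub, map_smul, map_smul, map_smul, map_smul, inner_sub_right,
      inner_smul_right, inner_smul_right, ← hc, ← ha, h, inner_smul_right, inner_smul_right]
    linear_combination z * this
  have h1 := DFunLike.congr_fun hzero (m + 1)
  have h2 := DFunLike.congr_fun hzero m
  have hs : r = 0 := by
    have hne : ((Real.sqrt ((m : ℝ) + 1) : ℝ) : ℂ) ≠ 0 := by
      rw [Complex.ofReal_ne_zero]; positivity
    have he0 : e ≠ 0 := by rintro rfl; simp at he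
    have hm : m - 1 ≠ m + 1 := by omega
    simpa [hu, annihilation_single, creation_single, Finsupp.single_apply, hm, hne, he0,
      -Complex.ofReal_sinh] using h1
  refine ⟨?_, hs⟩
  subst hs
  rcases m with _ | m <;>
  simpa [hu, annihilation_single, creation_single, Finsupp.single_apply] using h2

/-! ### Spectrum and sums of the thermal state. -/

/-- The eigenvalues of the thermal state. -/
def thermalWeight (N : ℝ) (n : ℕ) : ℝ := 1 / (1 + N) * (N / (1 + N)) ^ n

section Thermal

variable {N : ℝ}

lemma thermal_ratio_nonneg (hN : 0 ≤ N) : 0 ≤ N / (1 + N) := by positivity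

lemma thermal_ratio_lt_one (hN : 0 ≤ N) : N / (1 + N) < 1 := by
  rw [div_lt_one (by positivity)]; linarith

lemma thermal_ket (hN : 0 ≤ N) (m : ℕ) : thermal N (ket m) = (thermalWeight N m : ℂ) • ket m := by
  have hs : Summable fun n : ℕ =>
      (((N / (1 + N)) ^ n : ℝ) : ℂ) • InnerProductSpace.rankOne ℂ (ket n) (ket n) := by
    refine Summable.of_norm_bounded
      (summable_geometric_of_lt_one (thermal_ratio_nonneg hN) (thermal_ratio_lt_one hN))
      fun n => ?_
    rw [norm_smul, InnerProductSpace.norm_rankOne, norm_ket, Complex.norm_real,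
      Real.norm_of_nonneg (pow_nonneg (thermal_ratio_nonneg hN) n)]
    simp
  have h := hs.hasSum.mapL (ContinuousLinearMap.apply ℂ Fock (ket m))
  have h' : HasSum (fun n : ℕ => ContinuousLinearMap.apply ℂ Fock (ket m)
      ((((N / (1 + N)) ^ n : ℝ) : ℂ) • InnerProductSpace.rankOne ℂ (ket n) (ket n)))
      ((((N / (1 + N)) ^ m : ℝ) : ℂ) • ket m) := by
    convert hasSum_single m fun n hn => ?_ using 1
    · simp
    · simp [inner_ket, ket_apply, hn]
  rw [thermal, smul_apply, ← ContinuousLinearMap.apply_apply (𝕜 := ℂ), h.unique h', smul_smul,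
    thermalWeight, Complex.ofReal_mul]

lemma inner_ket_thermal (hN : 0 ≤ N) (n : ℕ) (x : Fock) :
    inner ℂ (ket n) (thermal N x) = thermalWeight N n * x n := by
  have : innerSL ℂ (ket n) ∘L thermal N = (thermalWeight N n : ℂ) • innerSL ℂ (ket n) := by
    refine ext_ket fun m => ?_
    rw [ContinuousLinearMap.comp_apply, thermal_ket hN, map_smul, smul_apply, innerSL_apply_apply,
      inner_ket, ket_apply]
    split_ifs with h
    · rw [h]
    · simp
  simpa [inner_ket] using DFunLike.congr_fun this x

lemma isIncoherent_thermal (hN : 0 ≤ N) : IsIncoherent (thermal N) := fun m n hmn => by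
  rw [inner_ket_thermal hN, ket_apply, if_neg hmn, mul_zero]

lemma eq_zero_of_thermalWeight_eq (hN : 0 ≤ N) {n : ℕ} (h : thermalWeight N n = thermalWeight N 0) :
    n = 0 := by
  by_contra hn
  have h1 := pow_lt_one₀ (thermal_ratio_nonneg hN) (thermal_ratio_lt_one hN) hn
  have h2 : (1 / (1 + N)) ≠ 0 := by positivity
  rw [thermalWeight, thermalWeight, pow_zero] at h
  exact h1.ne (mul_left_cancel₀ h2 h)

/-- Simplicity of the top eigenvalue: since N/(1+N) < 1, no other weight equals the one at n = 0,
even for N = 0. -/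
lemma eq_smul_ket_zero_of_thermal_eq (hN : 0 ≤ N) {x : Fock}
    (h : thermal N x = (thermalWeight N 0 : ℂ) • x) : x = x 0 • ket 0 := by
  ext n
  rw [lp.coeFn_smul, Pi.smul_apply, ket_apply, smul_eq_mul]
  split_ifs with hn
  · rw [hn, mul_one]
  · have h1 := inner_ket_thermal hN n x
    rw [h, inner_smul_right, inner_ket] at h1
    rw [mul_zero]
    by_contra hx
    have := mul_right_cancel₀ hx h1
    exact hn (eq_zero_of_thermalWeight_eq hN (Complex.ofReal_injective this).symm)

lemma hasSum_thermalWeight (hN : 0 ≤ N) : HasSum (thermalWeight N) 1 := by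
  have := (hasSum_geometric_of_lt_one (thermal_ratio_nonneg hN) (thermal_ratio_lt_one hN)).mul_left
    (1 / (1 + N))
  have hN' : 1 + N ≠ 0 := by positivity
  have h1 : 1 - N / (1 + N) = 1 / (1 + N) := by field_simp; ring
  rw [h1, inv_div, div_one, one_div_mul_cancel hN'] at this
  exact this

lemma hasSum_thermalWeight_mul (hN : 0 ≤ N) : HasSum (fun n => thermalWeight N n * n) N := by
  have := (hasSum_coe_mul_geometric_of_norm_lt_one (r := N / (1 + N)) (by
    rw [Real.norm_of_nonneg (thermal_ratio_nonneg hN)]; exact thermal_ratio_lt_one hN)).mul_left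
    (1 / (1 + N))
  have hN' : 1 + N ≠ 0 := by positivity
  have h1 : 1 / (1 + N) * (N / (1 + N) / (1 - N / (1 + N)) ^ 2) = N := by
    have h2 : 1 - N / (1 + N) = 1 / (1 + N) := by field_simp; ring
    rw [h2]
    field_simp
  rw [h1] at this
  have h3 : (fun n : ℕ => thermalWeight N n * n) =
      fun n : ℕ => 1 / (1 + N) * (n * (N / (1 + N)) ^ n) := by
    ext n
    rw [thermalWeight]
    ring
  rw [h3]
  exact this

lemma hasExpectation_thermal (hN : 0 ≤ N) {A : Module.End ℂ FiniteFock} {x : ℝ} {f : ℕ → ℝ}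
    (hA : ∀ n, A (Finsupp.single n 1) n = f n) (hf : HasSum (fun n => thermalWeight N n * f n) x) :
    HasExpectation (thermal N) A x := by
  rw [HasExpectation]
  simp only [inner_ket_thermal hN, incl_apply, hA, ← Complex.ofReal_mul]
  exact Complex.hasSum_ofReal.2 hf

end Thermal

/-! ### Moments of the thermal state. -/

lemma annihilation_single_apply_self (n : ℕ) (z : ℂ) :
    annihilation (Finsupp.single n z) n = 0 := by
  rw [annihilation_single]
  rcases n with _ | n <;> simp

lemma creation_single_apply_self (n : ℕ) (z : ℂ) : creation (Finsupp.single n z) n = 0 := by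
  rw [creation_single]
  simp

lemma ladder_apply_self (z z' : ℂ) (n : ℕ) :
    (z • annihilation + z' • creation) (Finsupp.single n 1) n = 0 := by
  simp [annihilation_single_apply_self, creation_single_apply_self]

lemma ladder_mul_ladder_apply_self (z z' w w' : ℂ) (n : ℕ) :
    ((z • annihilation + z' • creation) * (w • annihilation + w' • creation))
      (Finsupp.single n 1) n = z * w' * (n + 1) + z' * w * n := by
  have h1 : annihilation (annihilation (Finsupp.single n 1)) n = 0 := by
    rw [annihilation_single, annihilation_single]
    rcases n with _ | n
    · simp
    · rw [Finsupp.single_apply, if_neg (by omega)]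
  have h2 : creation (creation (Finsupp.single n 1)) n = 0 := by
    rw [creation_single, creation_single, Finsupp.single_apply, if_neg (by omega)]
  have h3 : creation (annihilation (Finsupp.single n 1)) n = n := by
    rw [annihilation_single, creation_single]
    rcases n with _ | n
    · simp
    · rw [Nat.add_sub_cancel, Finsupp.single_eq_same, one_mul, ← Complex.ofReal_mul]
      push_cast
      rw [← Complex.ofReal_mul, Real.mul_self_sqrt (by positivity)]
      push_cast; ring
  have h4 : annihilation (creation (Finsupp.single n 1)) n = n + 1 := by
    have := LinearMap.congr_fun annihilation_mul_creation (Finsupp.single n 1)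
    simp only [Module.End.mul_apply, LinearMap.add_apply, Module.End.one_apply] at this
    rw [this, Finsupp.add_apply, h3, Finsupp.single_eq_same]
  simp only [Module.End.mul_apply, LinearMap.add_apply, LinearMap.smul_apply, map_add, map_smul,
    Finsupp.add_apply, Finsupp.smul_apply, h1, h2, h3, h4, smul_eq_mul]
  ring

lemma quadrature_eq (j : Fin 2) : quadrature j =
    (![1 / (Real.sqrt 2 : ℂ), 1 / (Complex.I * (Real.sqrt 2 : ℂ))] j : ℂ) • annihilation +
    (![1 / (Real.sqrt 2 : ℂ), -(1 / (Complex.I * (Real.sqrt 2 : ℂ)))] j : ℂ) • creation := by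
  fin_cases j
  · simp [quadrature]
  · simp only [quadrature, Fin.mk_one, Matrix.cons_val_one, Matrix.cons_val_fin_one, end_sub_eq]
    module

lemma hasCovarianceMatrix_thermal {N : ℝ} (hN : 0 ≤ N) :
    HasCovarianceMatrix (thermal N) (((1 + 2 * N) / 2) • (1 : Matrix (Fin 2) (Fin 2) ℝ)) := by
  refine ⟨0, fun j => ?_, fun j k => ?_⟩
  · refine hasExpectation_thermal hN (f := 0) (fun n => ?_) (by simp)
    rw [quadrature_eq, ladder_apply_self]
    simp
  · have hs : ((Real.sqrt 2 : ℝ) : ℂ)⁻¹ * ((Real.sqrt 2 : ℝ) : ℂ)⁻¹ = 2⁻¹ := by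
      rw [← mul_inv, ← Complex.ofReal_mul, Real.mul_self_sqrt (by norm_num)]; simp
    have hI := Complex.I_mul_I
    -- A diagonal state sees only diagonal entries. For the symmetrised products these are (n + 1/2)
    -- δ_jk, which average to N + 1/2.
    refine hasExpectation_thermal hN
      (f := fun n => (n + 1 / 2) * (1 : Matrix (Fin 2) (Fin 2) ℝ) j k) (fun n => ?_) ?_
    · rw [LinearMap.smul_apply, LinearMap.add_apply, Finsupp.smul_apply, Finsupp.add_apply,
        quadrature_eq, quadrature_eq, ladder_mul_ladder_apply_self, ladder_mul_ladder_apply_self]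
      fin_cases j <;> fin_cases k <;> simp
      · linear_combination (2 * (n : ℂ) + 1) * hs
      · ring
      · ring
      · linear_combination (-(2 * (n : ℂ) + 1) * Complex.I ^ 2) * hs -
          ((2 * (n : ℂ) + 1) / 2) * hI
    · have h := ((hasSum_thermalWeight_mul hN).add ((hasSum_thermalWeight hN).div_const 2)).mul_right
        ((1 : Matrix (Fin 2) (Fin 2) ℝ) j k)
      have e : (N + 1 / 2) * (1 : Matrix (Fin 2) (Fin 2) ℝ) j k =
          (((1 + 2 * N) / 2) • (1 : Matrix (Fin 2) (Fin 2) ℝ)) j k + (0 : Fin 2 → ℝ) j *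
            (0 : Fin 2 → ℝ) k := by
        rw [Matrix.smul_apply, smul_eq_mul, Pi.zero_apply, zero_mul, add_zero]
        ring
      rw [e] at h
      have e' : (fun n : ℕ => thermalWeight N n *
          ((n + 1 / 2) * (1 : Matrix (Fin 2) (Fin 2) ℝ) j k)) = fun n : ℕ =>
          (thermalWeight N n * n + thermalWeight N n / 2) * (1 : Matrix (Fin 2) (Fin 2) ℝ) j k := by
        ext n
        ring
      rw [e']
      exact h

/-! ### Incoherence forces zero displacement and squeezing. -/

/-- An incoherent Gaussian state is neither displaced nor squeezed. -/
theorem IsIncoherent.eq_zero {β : ℂ} {r ψ N : ℝ} (hN : 0 ≤ N)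
    (h : IsIncoherent (gaussianState β r ψ N)) : β = 0 ∧ r = 0 := by
  set e := Complex.exp (Complex.I * (ψ : ℂ)) with he_def
  have he : e * starRingEnd ℂ e = 1 := by
    rw [Complex.mul_conj, Complex.normSq_eq_norm_sq, he_def, mul_comm, Complex.norm_exp_ofReal_mul_I]
    simp
  set D := displacement β with hD
  set S := squeezing (r * e) with hS
  set ρ := gaussianState β r ψ N with hρ
  have hρ' : ∀ x, ρ x = D (S (thermal N (ContinuousLinearMap.adjoint S
    (ContinuousLinearMap.adjoint D x)))) := fun x => rfl
  have hD1 : ∀ x, ContinuousLinearMap.adjoint D (D x) = x := fun x =>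
    DFunLike.congr_fun (displacement_mem_unitary β).1 x
  have hD2 : ∀ x, D (ContinuousLinearMap.adjoint D x) = x := fun x =>
    DFunLike.congr_fun (displacement_mem_unitary β).2 x
  have hS1 : ∀ x, ContinuousLinearMap.adjoint S (S x) = x := fun x =>
    DFunLike.congr_fun (squeezing_mem_unitary (r * e)).1 x
  have hS2 : ∀ x, S (ContinuousLinearMap.adjoint S x) = x := fun x =>
    DFunLike.congr_fun (squeezing_mem_unitary (r * e)).2 x
  set φ := D (S (ket 0)) with hφ
  have hρφ : ρ φ = (thermalWeight N 0 : ℂ) • φ := by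
    rw [hρ', hφ, hD1, hS1, thermal_ket hN, map_smul, map_smul]
  have hφ0 : φ ≠ 0 := by
    rw [← norm_ne_zero_iff, hφ, norm_apply_of_mem_unitary (displacement_mem_unitary β),
      norm_apply_of_mem_unitary (squeezing_mem_unitary _), norm_ket]
    exact one_ne_zero
  obtain ⟨m, hm⟩ : ∃ m, φ m ≠ 0 := by
    by_contra! hall
    exact hφ0 (lp.ext (funext hall))
  set l := inner ℂ (ket m) (ρ (ket m)) with hl
  -- Row m of the diagonal matrix, applied to φ, identifies the entry l with the top eigenvalue
  -- because φ m ≠ 0; column m then makes |m⟩ an eigenvector.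
  have hdiag : innerSL ℂ (ket m) ∘L ρ = l • innerSL ℂ (ket m) := by
    refine ext_ket fun n => ?_
    rw [ContinuousLinearMap.comp_apply, smul_apply, innerSL_apply_apply, innerSL_apply_apply,
      inner_ket m (ket n), ket_apply]
    split_ifs with hmn
    · rw [← hmn, hl, smul_eq_mul, mul_one]
    · rw [h m n hmn, smul_zero]
  have hl0 : l = thermalWeight N 0 := by
    have := DFunLike.congr_fun hdiag φ
    rw [ContinuousLinearMap.comp_apply, smul_apply, innerSL_apply_apply, innerSL_apply_apply, hρφ,
      inner_smul_right, inner_ket, smul_eq_mul] at this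
    exact (mul_right_cancel₀ hm this).symm
  have hρm : ρ (ket m) = (thermalWeight N 0 : ℂ) • ket m := by
    ext n
    rw [← inner_ket, lp.coeFn_smul, Pi.smul_apply, ket_apply]
    split_ifs with hnm
    · rw [hnm, ← hl, hl0, smul_eq_mul, mul_one]
    · rw [h n m hnm, smul_zero]
  have hν : thermal N (ContinuousLinearMap.adjoint S (ContinuousLinearMap.adjoint D (ket m))) =
      (thermalWeight N 0 : ℂ) •
        ContinuousLinearMap.adjoint S (ContinuousLinearMap.adjoint D (ket m)) := by
    rw [← map_smul, ← map_smul, ← hρm, hρ', hD1, hS1]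
  have hket := congrArg S (eq_smul_ket_zero_of_thermal_eq hN hν)
  rw [hS2, map_smul] at hket
  exact eq_zero_of_adjoint_displacement_ket he hket

lemma gaussianState_zero (ψ N : ℝ) : gaussianState 0 0 ψ N = thermal N := by
  have h1 : ContinuousLinearMap.adjoint (1 : Fock →L[ℂ] Fock) = 1 := star_one _
  simp [gaussianState, displacement_zero, squeezing_zero, h1]

end SingleMode
end

theorem mainTheorem1 :
    (∀ (β : ℂ) (r ψ N : ℝ), 0 ≤ N →
      (SingleMode.IsIncoherent (SingleMode.gaussianState β r ψ N) ↔
        (∃ σ : Matrix (Fin 2) (Fin 2) ℝ,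
          SingleMode.HasCovarianceMatrix (SingleMode.gaussianState β r ψ N) σ ∧ σ.IsDiag) ∧
        β = 0 ∧ r = 0) ∧
      (SingleMode.IsIncoherent (SingleMode.gaussianState β r ψ N) ↔ β = 0 ∧ r = 0) ∧
      (SingleMode.IsIncoherent (SingleMode.gaussianState β r ψ N) ↔
        SingleMode.gaussianState β r ψ N = SingleMode.thermal N) ∧
      (SingleMode.IsIncoherent (SingleMode.gaussianState β r ψ N) →
        SingleMode.HasCovarianceMatrix (SingleMode.gaussianState β r ψ N)
          (((1 + 2 * N) / 2) • (1 : Matrix (Fin 2) (Fin 2) ℝ)))) ∧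
    (∀ ρ : SingleMode.Fock →L[ℂ] SingleMode.Fock,
      (SingleMode.IsGaussianState ρ ∧ SingleMode.IsIncoherent ρ) ↔
        ∃ N : ℝ, 0 ≤ N ∧ ρ = SingleMode.thermal N) := by
  have key : ∀ (β : ℂ) (r ψ N : ℝ), 0 ≤ N →
      SingleMode.IsIncoherent (SingleMode.gaussianState β r ψ N) →
      SingleMode.gaussianState β r ψ N = SingleMode.thermal N := by
    intro β r ψ N hN h
    obtain ⟨rfl, rfl⟩ := h.eq_zero hN
    exact SingleMode.gaussianState_zero ψ N
  have zero : ∀ (β : ℂ) (r ψ N : ℝ), 0 ≤ N → β = 0 ∧ r = 0 →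
      SingleMode.IsIncoherent (SingleMode.gaussianState β r ψ N) := by
    rintro β r ψ N hN ⟨rfl, rfl⟩
    rw [SingleMode.gaussianState_zero]
    exact SingleMode.isIncoherent_thermal hN
  refine ⟨fun β r ψ N hN => ⟨⟨fun h => ⟨⟨((1 + 2 * N) / 2) • 1, ?_, ?_⟩, h.eq_zero hN⟩, fun h => zero β r ψ N hN h.2⟩,
    ⟨fun h => h.eq_zero hN, zero β r ψ N hN⟩, ⟨key β r ψ N hN, fun h => ?_⟩, fun h => ?_⟩,
    fun ρ => ⟨?_, ?_⟩⟩
  · rw [key β r ψ N hN h]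
    exact SingleMode.hasCovarianceMatrix_thermal hN
  · exact Matrix.isDiag_one.smul _
  · rw [h]
    exact SingleMode.isIncoherent_thermal hN
  · rw [key β r ψ N hN h]
    exact SingleMode.hasCovarianceMatrix_thermal hN
  · rintro ⟨⟨β, r, ψ, N, hN, rfl⟩, h⟩
    exact ⟨N, hN, key β r ψ N hN h⟩
  · rintro ⟨N, hN, rfl⟩
    exact ⟨⟨0, 0, 0, N, hN, (SingleMode.gaussianState_zero 0 N).symm⟩,
      SingleMode.isIncoherent_thermal hN⟩
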